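/- Let $n\ge 0$ and let $w_0$ be the longest element of the symmetric group $S_n$. For $k\le n$ let $\Delta_k(t|X_k)$ be the determinant of the tridiagonal $k\times k$ matrix with diagonal entries $x_1+t,\dots,x_k+t$, entries $q_1,\dots,q_{k-1}$ just above the diagonal and entries $-1$ just below it. The quantum elementary symmetric polynomials $\tilde e_1,\dots,\tilde e_n\in\mathbb Z[q_1,\dots,q_{n-1}][x_1,\dots,x_n]$ are given by $\Delta_n(t|X_n)=t^n+\sum_{i=1}^n\tilde e_i\,t^{n-i}$, and $\tilde I_n$ is the ideal that they generate. The quantum Schubert polynomial of $w\in S_n$ is $$\tilde{\mathfrak S}_w(x)=\partial^{(y)}_{ww_0}\prod_{i=1}^{n-1}\Delta_i(y_{n-i}|X_i)\Big|_{y=0},$$ where $\partial_v^{(y)}$ is the divided difference operator of $v$ in the variables $y_1,\dots,y_n$. Let $t=(t_w)_{w\in S_n}$ be independent variables, $R=\mathbb Q[[q_1,\dots,q_{n-1},\{t_w\}_{w\in S_n}]]$ and $k=\operatorname{Frac}R$. Let $K(x,t)=\sum_w\varphi_w(t)\,\tilde{\mathfrak S}_{ww_0}(x)$, $\varphi_w\in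 R$, be the projection of $\exp\big(\sum_w t_w\tilde{\mathfrak S}_w(x)\big)\in\mathbb Q[x_1,\dots,x_n][[q,t]]$, modulo the ideal generated by $\tilde I_n$, to the $R$-span of the quantum Schubert polynomials. On $k[x_1,\dots,x_n]$ let $\langle f\rangle_{\tilde I_n}$ be the Grothendieck residue with respect to $\tilde e_1,\dots,\tilde e_n$, and let $\langle f,g\rangle_t=\langle fgK\rangle_{\tilde I_n}$. For $w\in S_n$ let $c(w)=(c_1,\dots,c_n)$, $c_i=\#\{j>i: w(j)<w(i)\}$, be its code; $w\mapsto c(w)$ is a bijection from $S_n$ to the set of exponents $I$ with $0\le I_i\le n-i$, that is $I\subset\delta_n=(n-1,n-2,\dots,0)$. Let $(X_w^t)_{w\in S_n}$ be the Gram–Schmidt orthogonalization of the lexicographically ordered monomials $x^{c(w)}$ with respect to $\langle\ ,\ \rangle_t$: $$X_w^t=x^{c(w)}-\sum_{v:\ c(v)<_{\rm lex}c(w)}\frac{\langle x^{c(w)},X_v^t\rangle_t}{\langle X_v^t,X_v^t\rangle_t}\,X_v^t\ \in k[x_1,\dots,x_n].$$ Let $\partial/\partial t_w$ act on $k$ by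 the quotient rule, and on $k[x_1,\dots,x_n]$ coefficientwise. Then for every $w\in S_n$ there are a unique $S_n\times S_n$ matrix $L_w$ and a unique $S_n\times S_n$ matrix $M_w$ over $k$ such that, for all $v\in S_n$, $$\tilde{\mathfrak S}_wX_v^t\equiv\sum_{u}(L_w)_{vu}X_u^t \pmod{\tilde I_n\,k[x_1,\dots,x_n]},\qquad \frac{\partial}{\partial t_w}X_v^t=\sum_u (M_w)_{vu}X_u^t ,$$ and these matrices satisfy, for all $u,w\in S_n$, $$\frac{\partial}{\partial t_u}L_w=[M_u,L_w]=M_uL_w-L_wM_u ,$$ where $\partial/\partial t_u$ is applied to $L_w$ entry by entry. -/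

import Mathlib

open MvPolynomial

noncomputable section

namespace FlagLax

/-! ### Quantum elementary symmetric polynomials -/

/-- The ring `ℤ[q₁, …, q_{n-1}]`; the variable `X i` with `i : Fin (n - 1)` is `q_{i+1}`. -/
abbrev QRing (n : ℕ) : Type := MvPolynomial (Fin (n - 1)) ℤ

/-- The ring `ℤ[q₁, …, q_{n-1}][x₁, …, x_n]`; the variable `X i` with `i : Fin n` is `x_{i+1}`. -/
abbrev QPoly (n : ℕ) : Type := MvPolynomial (Fin n) (QRing n)

/-- The variable `x_{i+1}`; indices out of range are never used. -/
def xVar (n i : ℕ) : QPoly n := if h : i < n then X ⟨i, h⟩ else 0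

/-- The variable `q_{i+1}`; indices out of range are never used. -/
def qVar (n i : ℕ) : QPoly n := if h : i < n - 1 then C (X ⟨i, h⟩) else 0

/-- The determinant `Δ_k(t | X_k)` of the tridiagonal `k × k` matrix with `x_i + t` on the
diagonal, `q_i` above the diagonal and `-1` below it, where `t` is an element of a commutative ring
`S` to which `ℤ[q][x]` is mapped by `φ`. -/
def Delta (n k : ℕ) {S : Type} [CommRing S] (φ : QPoly n →+* S) (t : S) : S :=
  Matrix.det (Matrix.of fun i j : Fin k =>
    if i = j then φ (xVar n i) + t
    else if (j : ℕ) = i + 1 then φ (qVar n i)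
    else if (i : ℕ) = j + 1 then -1
    else 0)

/-- `quantumE n i` is the quantum elementary symmetric polynomial
`e_{i+1}(X_n | q₁, …, q_{n-1})`, the coefficient of `t^{n-(i+1)}` in `Δ_n(t | X_n)`. -/
def quantumE (n : ℕ) (i : Fin n) : QPoly n :=
  (Delta n n Polynomial.C Polynomial.X).coeff (n - (i + 1))

/-- The ideal `Ĩ_n` of `ℤ[q][x]` generated by the quantum elementary symmetric polynomials. -/
def quantumIdeal (n : ℕ) : Ideal (QPoly n) := Ideal.span (Set.range (quantumE n))

/-! ### Divided differences -/

theorem sub_dvd_sub_rename_swap {T σ : Type} [CommRing T] [DecidableEq σ] (i j : σ)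
    (f : MvPolynomial σ T) :
    (X i - X j : MvPolynomial σ T) ∣ f - rename (Equiv.swap i j) f := by
  induction f using MvPolynomial.induction_on with
  | C a => simp
  | add p r hp hr =>
    have h := dvd_add hp hr
    have e : p + r - rename (Equiv.swap i j) (p + r) =
        (p - rename (Equiv.swap i j) p) + (r - rename (Equiv.swap i j) r) := by
      rw [map_add]; ring
    rw [e]; exact h
  | mul_X p k hp =>
    have e : p * X k - rename (Equiv.swap i j) (p * X k) =
        (p - rename (Equiv.swap i j) p) * X k +
          rename (Equiv.swap i j) p * (X k - X (Equiv.swap i j k)) := by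
      rw [map_mul, rename_X]; ring
    rw [e]
    refine dvd_add (dvd_mul_of_dvd_left hp _) (dvd_mul_of_dvd_right ?_ _)
    by_cases h1 : k = i
    · subst h1; simp
    · by_cases h2 : k = j
      · subst h2
        rw [Equiv.swap_apply_right]
        exact ⟨-1, by ring⟩
      · rw [Equiv.swap_apply_of_ne_of_ne h1 h2]; simp

/-- The divided difference `(f - s f) / (y_i - y_j)`, where `s` interchanges `y_i` and `y_j`. -/
def divDiff {T σ : Type} [CommRing T] [DecidableEq σ] (i j : σ) (f : MvPolynomial σ T) :
    MvPolynomial σ T :=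
  (sub_dvd_sub_rename_swap i j f).choose

/-- The index `i` of a simple transposition, as a position. -/
def lo {n : ℕ} (i : Fin (n - 1)) : Fin n := ⟨i, by omega⟩

/-- The index `i + 1`, as a position. -/
def hi {n : ℕ} (i : Fin (n - 1)) : Fin n := ⟨i + 1, by omega⟩

/-- The permutation with a given word in the simple transpositions. -/
def wordProd {n : ℕ} (l : List (Fin (n - 1))) : Equiv.Perm (Fin n) :=
  (l.map fun i => (Equiv.swap (lo i) (hi i) : Equiv.Perm (Fin n))).prod

theorem exists_word {n : ℕ} (v : Equiv.Perm (Fin n)) :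
    ∃ l : List (Fin (n - 1)), wordProd l = v := by
  cases n with
  | zero => exact ⟨[], Subsingleton.elim _ _⟩
  | succ m =>
    have hv : v ∈ Submonoid.closure
        (Set.range fun i : Fin m => Equiv.swap i.castSucc i.succ) := by
      rw [Equiv.Perm.mclosure_swap_castSucc_succ]; trivial
    induction hv using Submonoid.closure_induction with
    | mem x hx =>
      obtain ⟨i, rfl⟩ := hx
      exact ⟨[i], by simp only [wordProd, List.map_cons, List.map_nil, List.prod_singleton]; rfl⟩
    | one => exact ⟨[], rfl⟩
    | mul x y _ _ hx hy =>
      obtain ⟨l, rfl⟩ := hx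
      obtain ⟨l', rfl⟩ := hy
      exact ⟨l ++ l', by simp [wordProd]⟩

theorem exists_reducedWord {n : ℕ} (v : Equiv.Perm (Fin n)) :
    ∃ l : List (Fin (n - 1)), wordProd l = v ∧
      ∀ l' : List (Fin (n - 1)), wordProd l' = v → l.length ≤ l'.length := by
  obtain ⟨l, hl, hmin⟩ := (measure (List.length (α := Fin (n - 1)))).wf.has_min
    {l | wordProd l = v} (exists_word v)
  exact ⟨l, hl, fun l' hl' => not_lt.mp (hmin l' hl')⟩

/-- A reduced word (a shortest word in the simple transpositions) of a permutation. -/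
def reducedWord {n : ℕ} (v : Equiv.Perm (Fin n)) : List (Fin (n - 1)) :=
  (exists_reducedWord v).choose

/-- The divided difference operator `∂_v = ∂_{a₁} ∘ ⋯ ∘ ∂_{a_l}`, where `s_{a₁} ⋯ s_{a_l}` is a
reduced word of `v` (by the braid relations, the operator does not depend on the word). -/
def divDiffPerm {n : ℕ} {T : Type} [CommRing T] (v : Equiv.Perm (Fin n))
    (f : MvPolynomial (Fin n) T) : MvPolynomial (Fin n) T :=
  (reducedWord v).foldr (fun i g => divDiff (lo i) (hi i) g) f

/-! ### Quantum Schubert polynomials -/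

/-- The longest element `w₀` of `S_n`. -/
def w0 (n : ℕ) : Equiv.Perm (Fin n) := Fin.revPerm

/-- The variable `y_{i+1}` over `ℤ[q][x]`; indices out of range are never used. -/
def yVar (n i : ℕ) : MvPolynomial (Fin n) (QPoly n) := if h : i < n then X ⟨i, h⟩ else 0

/-- The top quantum double Schubert polynomial `∏_{i=1}^{n-1} Δ_i(y_{n-i} | X_i)`. -/
def topDoubleSchubert (n : ℕ) : MvPolynomial (Fin n) (QPoly n) :=
  ∏ i ∈ Finset.Icc 1 (n - 1), Delta n i C (yVar n (n - i - 1))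

/-- The quantum double Schubert polynomial of `w`. -/
def doubleSchubert {n : ℕ} (w : Equiv.Perm (Fin n)) : MvPolynomial (Fin n) (QPoly n) :=
  divDiffPerm (w * w0 n) (topDoubleSchubert n)

/-- The quantum Schubert polynomial of `w`: the specialization `y = 0` of the double one. -/
def schubert {n : ℕ} (w : Equiv.Perm (Fin n)) : QPoly n := constantCoeff (doubleSchubert w)

/-! ### Power series in `q` and `t` -/

/-- The parameters: `Sum.inl i` stands for `q_{i+1}` and `Sum.inr w` for `t_w`. -/
abbrev Param (n : ℕ) : Type := Fin (n - 1) ⊕ Equiv.Perm (Fin n)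

/-- The ring `ℚ[[q₁, …, q_{n-1}, {t_w}]]`. -/
abbrev SeriesRing (n : ℕ) : Type := MvPowerSeries (Param n) ℚ

/-- The field of fractions of `ℚ[[q₁, …, q_{n-1}, {t_w}]]`. -/
abbrev SeriesField (n : ℕ) : Type := FractionRing (SeriesRing n)

/-- The ring `ℚ[x₁, …, x_n][[q₁, …, q_{n-1}, {t_w}]]`. -/
abbrev BigRing (n : ℕ) : Type := MvPowerSeries (Param n) (MvPolynomial (Fin n) ℚ)

/-- The inclusion of `ℤ[q]` in `ℚ[[q, t]]`. -/
def qToSeries (n : ℕ) : QRing n →+* SeriesRing n :=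
  eval₂Hom (Int.castRingHom _) fun i => MvPowerSeries.X (Sum.inl i)

/-- The inclusion of `ℚ[[q, t]]` in `ℚ[x][[q, t]]`. -/
def seriesToBig (n : ℕ) : SeriesRing n →+* BigRing n := MvPowerSeries.map C

/-- The inclusion of `ℤ[q][x]` in `ℚ[x][[q, t]]`. -/
def polyToBig (n : ℕ) : QPoly n →+* BigRing n :=
  eval₂Hom ((seriesToBig n).comp (qToSeries n)) fun j => MvPowerSeries.C (X j)

/-- The inclusion of `ℤ[q][x]` in `k[x]`, where `k` is the fraction field of `ℚ[[q, t]]`. -/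
def polyToField (n : ℕ) : QPoly n →+* MvPolynomial (Fin n) (SeriesField n) :=
  MvPolynomial.map ((algebraMap (SeriesRing n) (SeriesField n)).comp (qToSeries n))

/-- The ideal of `k[x]` generated by the quantum elementary symmetric polynomials. -/
def fieldIdeal (n : ℕ) : Ideal (MvPolynomial (Fin n) (SeriesField n)) :=
  (quantumIdeal n).map (polyToField n)

/-! ### The kernel -/

/-- The series `exp (∑_w t_w S̃_w(x))` in `ℚ[x][[q, t]]`. -/
def expSeries (n : ℕ) : BigRing n :=
  (PowerSeries.exp ℚ).subst
    (∑ w : Equiv.Perm (Fin n), MvPowerSeries.X (Sum.inr w) * polyToBig n (schubert w) : BigRing n)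

/-- The family `φ_w ∈ ℚ[[q, t]]` is that of the coefficients of the projection
`∑_w φ_w S̃_{w w₀}` of `exp (∑_w t_w S̃_w)`, modulo the ideal generated by `Ĩ_n`, to the span of the
quantum Schubert polynomials. -/
def IsKernelCoeff (n : ℕ) (φ : Equiv.Perm (Fin n) → SeriesRing n) : Prop :=
  expSeries n - ∑ w, seriesToBig n (φ w) * polyToBig n (schubert (w * w0 n)) ∈
    (quantumIdeal n).map (polyToBig n)

/-- The coefficients `φ_w` of the kernel (they exist and are unique, because the quantum Schubert
polynomials form a basis modulo `Ĩ_n`). -/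
def kernelCoeff (n : ℕ) : Equiv.Perm (Fin n) → SeriesRing n := Classical.epsilon (IsKernelCoeff n)

/-- The kernel `K(x, t) = ∑_w φ_w(t) S̃_{w w₀}(x)`. -/
def kernel (n : ℕ) : MvPolynomial (Fin n) (SeriesField n) :=
  ∑ w, C (algebraMap (SeriesRing n) (SeriesField n) (kernelCoeff n w)) *
    polyToField n (schubert (w * w0 n))

/-! ### The Grothendieck residue -/

/-- For polynomials `g₁, …, g_n` in `n` variables over a field `k` with finite-dimensional quotient
`A = k[x] / (g)`, the Grothendieck residue with respect to `g` is the unique `k`-linear functional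
`τ` on `A` that takes the class of the Bezoutian in `A ⊗ A` to `1`, that is `(id ⊗ τ)(det a) = 1`
in `A`, where `g_i(y) - g_i(x) = ∑_j a_{ij}(x, y) (y_j - x_j)` (the class of `det a` in `A ⊗ A` does
not depend on the choice of `a`).  Polynomials in `x` and `y` are written as polynomials in `y`
with coefficients in `k[x]`, and `id ⊗ τ` applies `τ` to the monomials in `y`. -/
def IsResidue {k : Type} [Field k] {n : ℕ} (g : Fin n → MvPolynomial (Fin n) k)
    (τ : MvPolynomial (Fin n) k →ₗ[k] k) : Prop :=
  (∀ f ∈ Ideal.span (Set.range g), τ f = 0) ∧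
  ∃ a : Matrix (Fin n) (Fin n) (MvPolynomial (Fin n) (MvPolynomial (Fin n) k)),
    (∀ i, MvPolynomial.map C (g i) - C (g i) = ∑ j, a i j * (X j - C (X j))) ∧
    (∑ m ∈ a.det.support, τ (monomial m 1) • a.det.coeff m) - 1 ∈ Ideal.span (Set.range g)

/-- The Grothendieck residue with respect to `g₁, …, g_n`. -/
def residue {k : Type} [Field k] {n : ℕ} (g : Fin n → MvPolynomial (Fin n) k) :
    MvPolynomial (Fin n) k →ₗ[k] k :=
  Classical.epsilon (IsResidue g)

/-- The pairing `⟨f, g⟩_t = ⟨f g K(x, t)⟩`, where `⟨ ⟩` is the Grothendieck residue with respect to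
the quantum elementary symmetric polynomials. -/
def pairing {n : ℕ} (f g : MvPolynomial (Fin n) (SeriesField n)) : SeriesField n :=
  residue (fun i => polyToField n (quantumE n i)) (f * g * kernel n)

/-! ### Gram–Schmidt orthogonalization -/

/-- The code of `w`: its `i`-th entry is the number of `j > i` with `w j < w i`.  This is a bijection
from `S_n` to the sequences `I` with `I ⊂ (n-1, n-2, …, 1, 0)`. -/
def code {n : ℕ} (w : Equiv.Perm (Fin n)) (i : Fin n) : ℕ :=
  (Finset.univ.filter fun j => i < j ∧ w j < w i).card

/-- The monomial `x^I` whose exponent `I` is the code of `w`. -/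
def codeMonomial {n : ℕ} (w : Equiv.Perm (Fin n)) : MvPolynomial (Fin n) (SeriesField n) :=
  ∏ i, X i ^ code w i

open scoped Classical in
/-- The Gram–Schmidt orthogonalization of the lexicographically ordered monomials `x^I`,
`I ⊂ (n-1, …, 1, 0)`, with respect to the pairing `⟨ , ⟩_t`; the monomials are indexed by
permutations through the code. -/
def gramSchmidtX {n : ℕ} (w : Equiv.Perm (Fin n)) : MvPolynomial (Fin n) (SeriesField n) :=
  codeMonomial w - ∑ v : Equiv.Perm (Fin n),
    if _h : toLex (code v) < toLex (code w) then
      C (pairing (codeMonomial w) (gramSchmidtX v) / pairing (gramSchmidtX v) (gramSchmidtX v)) *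
        gramSchmidtX v
    else 0
termination_by (wellFounded_lt (α := Lex (Fin n → ℕ))).wrap (toLex (code w))
decreasing_by all_goals exact _h

/-! ### Derivatives with respect to `t_w` -/

/-- The derivation `∂/∂t_u` of the fraction field of `ℚ[[q, t]]`: the quotient rule
`(a / b)' = (a' b - a b') / b²`, applied to some representation `z = a / b`. -/
def dt {n : ℕ} (u : Equiv.Perm (Fin n)) (z : SeriesField n) : SeriesField n :=
  let p := IsLocalization.sec (nonZeroDivisors (SeriesRing n)) z
  let a : SeriesRing n := p.1
  let b : SeriesRing n := p.2
  algebraMap _ (SeriesField n)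
      (MvPowerSeries.pderiv ℚ (Sum.inr u) a * b - a * MvPowerSeries.pderiv ℚ (Sum.inr u) b) /
    algebraMap _ (SeriesField n) (b ^ 2)

/-- The derivative `∂f/∂t_u` of a polynomial in `x`, taken coefficient by coefficient. -/
def dtPoly {n : ℕ} (u : Equiv.Perm (Fin n)) (f : MvPolynomial (Fin n) (SeriesField n)) :
    MvPolynomial (Fin n) (SeriesField n) :=
  ∑ m ∈ f.support, monomial m (dt u (f.coeff m))

/-! ### The matrices -/

/-- `L` is the matrix of multiplication by `S̃_w` modulo `Ĩ_n`: `S̃_w X_v = ∑_u L_{vu} X_u`. -/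
def IsMulMatrix {n : ℕ} (w : Equiv.Perm (Fin n))
    (L : Matrix (Equiv.Perm (Fin n)) (Equiv.Perm (Fin n)) (SeriesField n)) : Prop :=
  ∀ v, polyToField n (schubert w) * gramSchmidtX v - ∑ u, C (L v u) * gramSchmidtX u ∈ fieldIdeal n

/-- `M` is the matrix of `∂/∂t_w`: `∂X_v/∂t_w = ∑_u M_{vu} X_u`. -/
def IsDerivMatrix {n : ℕ} (w : Equiv.Perm (Fin n))
    (M : Matrix (Equiv.Perm (Fin n)) (Equiv.Perm (Fin n)) (SeriesField n)) : Prop :=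
  ∀ v, dtPoly w (gramSchmidtX v) = ∑ u, C (M v u) * gramSchmidtX u

end FlagLax

end

open FlagLax

open MvPolynomial

noncomputable section

namespace FlagLax

/-! ### Staircase monomials modulo deformed elementary symmetric polynomials -/

/-! Differentiate S̃_w X_v ≡ ∑ L_{vu} X_u with respect to t_u. Neither S̃_w nor the generators of
the ideal involve t, so the derivation preserves the ideal (`dtPoly_mem_fieldIdeal`). The left side
becomes S̃_w ∑ M X ≡ ∑ (ML) X and the right side ∑ (∂L) X + ∑ (LM) X. Comparing coefficients gives
the Lax equation (`lax_equation`).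

This comparison, and the existence and uniqueness of L and M, need only two facts: the X_v form a
basis modulo the ideal (`gramSchmidtX_basis_mod`), and they span the same space of polynomials as
the monomials x^{c(w)}, which are constant in t. Since X_w is x^{c(w)} minus a combination of
earlier X_v, the second fact holds whatever the Gram–Schmidt coefficients are. It reduces the first
to the monomials x^{c(w)}, that is, to the staircase monomials.

For these, let g_1, …, g_n have leading forms e_1, …, e_n. Divide each exponent a_i by n - i (with i
counted from 0) and replace the quotient's power of x_i^{n-i} by a power of g_{n-i}. The resulting
products, over all exponents a, form a basis of the polynomial ring: they span degree by degree, and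
a dimension count makes them independent. Those with some nonzero quotient span the ideal (g_1, …,
g_n); the others are the staircase monomials (`staircase_basis_mod`). The quantum elementary
polynomials qualify as g_j because a non-identity permutation in the expansion of Δ_n loses degree
when each q_i has degree 0. -/

/-- The complete homogeneous symmetric polynomial of degree `m` in the variables of `s`. -/
def completeHomogeneous {σ : Type*} [DecidableEq σ] (R : Type*) [CommRing R] (s : Finset σ)
    (m : ℕ) : MvPolynomial σ R :=
  ∑ l ∈ s.finsuppAntidiag m, monomial l 1

/-! ### Relations between elementary and complete homogeneous polynomials -/

theorem coeff_prod_one_sub {σ : Type*} {R : Type*} [CommRing R] (s : Finset σ)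
    (x : σ → R) (p : ℕ) :
    PowerSeries.coeff p (∏ j ∈ s, (1 - PowerSeries.C (x j) * PowerSeries.X)) =
      (-1) ^ p * ∑ t ∈ s.powersetCard p, ∏ j ∈ t, x j := by
  classical
  have h : ∀ t ∈ s.powerset, PowerSeries.coeff p (∏ j ∈ t, (-(PowerSeries.C (x j) * PowerSeries.X)))
      = if t.card = p then (-1) ^ p * ∏ j ∈ t, x j else 0 := by
    intro t _
    have e : ∏ j ∈ t, (-(PowerSeries.C (x j) * PowerSeries.X)) =
        PowerSeries.C ((-1) ^ t.card * ∏ j ∈ t, x j) * PowerSeries.X ^ t.card := by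
      rw [Finset.prod_neg, Finset.prod_mul_distrib, Finset.prod_const]
      simp only [map_mul, map_pow, map_neg, map_one, map_prod]
      ring
    rw [e, PowerSeries.coeff_C_mul, PowerSeries.coeff_X_pow]
    by_cases hp : t.card = p
    · subst hp; simp
    · simp [hp, Ne.symm hp]
  simp only [sub_eq_add_neg]
  rw [Finset.prod_one_add, map_sum, Finset.sum_congr rfl h, ← Finset.sum_filter, Finset.mul_sum,
    Finset.powersetCard_eq_filter]

theorem coeff_prod_geometric {σ : Type*} [DecidableEq σ] {R : Type*} [CommRing R] (s : Finset σ)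
    (m : ℕ) :
    PowerSeries.coeff m (∏ j ∈ s, PowerSeries.mk fun k => (X j : MvPolynomial σ R) ^ k) =
      completeHomogeneous R s m := by
  rw [PowerSeries.coeff_prod, completeHomogeneous]
  refine Finset.sum_congr rfl fun l hl => ?_
  rw [Finset.mem_finsuppAntidiag] at hl
  simp only [PowerSeries.coeff_mk]
  rw [monomial_eq, C_1, one_mul, Finsupp.prod]
  refine (Finset.prod_subset hl.2 fun j _ hj => ?_).symm
  rw [Finsupp.notMem_support_iff.mp hj, pow_zero]

/-- Multiplying ∏ (1 - x_j T) over all variables by ∏ 1/(1 - x_j T) over `s` leaves the product over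
the complement of `s`, a polynomial in T of degree at most `sᶜ.card`. Its coefficient of T^m
therefore vanishes. -/
theorem sum_esymm_mul_completeHomogeneous {σ : Type*} [DecidableEq σ] [Fintype σ] {R : Type*}
    [CommRing R] (s : Finset σ) (m : ℕ) (hm : sᶜ.card < m) :
    ∑ p ∈ Finset.HasAntidiagonal.antidiagonal m,
      (-1) ^ p.1 * esymm σ R p.1 * completeHomogeneous R s p.2 = 0 := by
  have h1 : (∏ j ∈ s, (1 - PowerSeries.C (X j : MvPolynomial σ R) * PowerSeries.X)) *
      ∏ j ∈ s, PowerSeries.mk (fun k => (X j : MvPolynomial σ R) ^ k) = 1 := by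
    rw [← Finset.prod_mul_distrib]
    refine Finset.prod_eq_one fun j _ => ?_
    ext1 k
    rw [sub_mul, one_mul, map_sub, mul_assoc, PowerSeries.coeff_C_mul]
    cases k with
    | zero => simp
    | succ k => simp [PowerSeries.coeff_succ_X_mul, PowerSeries.coeff_one, pow_succ']
  have h2 : (∏ j, (1 - PowerSeries.C (X j : MvPolynomial σ R) * PowerSeries.X)) *
      ∏ j ∈ s, PowerSeries.mk (fun k => (X j : MvPolynomial σ R) ^ k) =
      ∏ j ∈ sᶜ, (1 - PowerSeries.C (X j : MvPolynomial σ R) * PowerSeries.X) := by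
    rw [← Finset.prod_mul_prod_compl s, mul_right_comm, h1, one_mul]
  have h3 := congrArg (PowerSeries.coeff m) h2
  rw [PowerSeries.coeff_mul, coeff_prod_one_sub, Finset.powersetCard_eq_empty.mpr hm,
    Finset.sum_empty, mul_zero] at h3
  rw [← h3]
  refine Finset.sum_congr rfl fun p _ => ?_
  rw [coeff_prod_one_sub, coeff_prod_geometric, esymm]

theorem totalDegree_completeHomogeneous_le {σ : Type*} [DecidableEq σ] {R : Type*} [CommRing R]
    (s : Finset σ) (m : ℕ) : (completeHomogeneous R s m).totalDegree ≤ m := by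
  refine totalDegree_finsetSum_le fun l hl => (totalDegree_monomial_le _ _).trans ?_
  rw [Finset.mem_finsuppAntidiag'] at hl
  exact hl.1.le

/-! ### A basis of the polynomial ring adapted to the ideal -/

section Staircase

variable {n : ℕ} {K : Type*} [Field K]

/-- The polynomials `∏ x_i ^ (a_i mod (n - i)) * g_{n-i} ^ (a_i / (n - i))`. -/
def staircaseProd (g : ℕ → MvPolynomial (Fin n) K) (a : Fin n →₀ ℕ) : MvPolynomial (Fin n) K :=
  ∏ i, X i ^ (a i % (n - i)) * g (n - i) ^ (a i / (n - i))

/-- The span of the `staircaseProd g a` with `a` of degree at most `d`. -/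
def staircaseSpan (g : ℕ → MvPolynomial (Fin n) K) (d : ℕ) :
    Submodule K (MvPolynomial (Fin n) K) :=
  Submodule.span K (staircaseProd g '' {a | a.degree ≤ d})

theorem staircaseSpan_mono (g : ℕ → MvPolynomial (Fin n) K) {d e : ℕ} (h : d ≤ e) :
    staircaseSpan g d ≤ staircaseSpan g e :=
  Submodule.span_mono (Set.image_mono fun _ ha => le_trans ha h)

/-- Adding n - i to a_i keeps the remainder and raises the quotient by one. Thus multiplication by a
generator merely shifts indices, which is what makes the ideal visible in this family. -/
theorem mul_staircaseProd (g : ℕ → MvPolynomial (Fin n) K) (i : Fin n) (a : Fin n →₀ ℕ) :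
    g (n - i) * staircaseProd g a = staircaseProd g (a + Finsupp.single i (n - i)) := by
  have hi : 0 < n - (i : ℕ) := by omega
  unfold staircaseProd
  rw [← Finset.mul_prod_erase _ _ (Finset.mem_univ i),
    ← Finset.mul_prod_erase (a := i) _ (fun j => X j ^ ((a + Finsupp.single i (n - i)) j % (n - j)) *
      g (n - j) ^ ((a + Finsupp.single i (n - i)) j / (n - j))) (Finset.mem_univ i)]
  have h : ∏ j ∈ Finset.univ.erase i, X j ^ ((a + Finsupp.single i (n - (i : ℕ))) j % (n - j)) *
      g (n - j) ^ ((a + Finsupp.single i (n - (i : ℕ))) j / (n - j)) =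
      ∏ j ∈ Finset.univ.erase i, X j ^ (a j % (n - j)) * g (n - j) ^ (a j / (n - j)) := by
    refine Finset.prod_congr rfl fun j hj => ?_
    rw [Finsupp.add_apply, Finsupp.single_eq_of_ne (Finset.ne_of_mem_erase hj), add_zero]
  rw [h]
  simp only [Finsupp.add_apply, Finsupp.single_eq_same, Nat.add_mod_right,
    Nat.add_div_right _ hi, pow_succ]
  ring

theorem mul_mem_staircaseSpan (g : ℕ → MvPolynomial (Fin n) K) {j d : ℕ} (hj : 1 ≤ j)
    (hjn : j ≤ n) {f : MvPolynomial (Fin n) K} (hf : f ∈ staircaseSpan g d) :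
    g j * f ∈ staircaseSpan g (d + j) := by
  obtain ⟨i, rfl⟩ : ∃ i : Fin n, n - (i : ℕ) = j := ⟨⟨n - j, by omega⟩, by simp; omega⟩
  induction hf using Submodule.span_induction with
  | mem x hx =>
    obtain ⟨a, ha, rfl⟩ := hx
    rw [mul_staircaseProd]
    refine Submodule.subset_span ⟨_, ?_, rfl⟩
    simp only [Set.mem_ofPred_eq, map_add, Finsupp.degree_single] at ha ⊢
    omega
  | zero => simp
  | add x y _ _ hx hy => rw [mul_add]; exact add_mem hx hy
  | smul c x _ hx => rw [mul_smul_comm]; exact Submodule.smul_mem _ _ hx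

/-- The exponents that are bounded strictly by `(n, n - 1, …, 1)`. -/
def staircase (n : ℕ) : Set (Fin n →₀ ℕ) := {a | ∀ i : Fin n, a i < n - i}

theorem staircaseProd_of_mem (g : ℕ → MvPolynomial (Fin n) K) {a : Fin n →₀ ℕ}
    (ha : a ∈ staircase n) : staircaseProd g a = monomial a 1 := by
  unfold staircaseProd
  rw [monomial_eq, C_1, one_mul, Finsupp.prod_fintype _ _ (by simp)]
  refine Finset.prod_congr rfl fun i _ => ?_
  rw [Nat.mod_eq_of_lt (ha i), Nat.div_eq_of_lt (ha i), pow_zero, mul_one]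

theorem mem_of_monomial_mem (S : Submodule K (MvPolynomial (Fin n) K)) (d : ℕ)
    (h : ∀ a : Fin n →₀ ℕ, a.degree ≤ d → monomial a 1 ∈ S) {p : MvPolynomial (Fin n) K}
    (hp : p.totalDegree ≤ d) : p ∈ S := by
  rw [p.as_sum]
  refine Submodule.sum_mem _ fun a ha => ?_
  rw [← mul_one (coeff a p), ← smul_eq_mul, ← smul_monomial]
  exact Submodule.smul_mem _ _ (h a ((le_totalDegree ha).trans hp))

/-- Off the staircase, some power x_i^m with m = n - i divides the monomial. The relation for
h_m(x_0, …, x_i) rewrites it through smaller monomials of the same degree, multiples of g_p, and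
terms of lower degree. -/
theorem monomial_mem_staircaseSpan (g : ℕ → MvPolynomial (Fin n) K)
    (hg : ∀ j, 1 ≤ j → j ≤ n → (g j - esymm (Fin n) K j).totalDegree < j) (d : ℕ) :
    ∀ a : Fin n →₀ ℕ, a.degree ≤ d → monomial a 1 ∈ staircaseSpan g d := by
  induction d using Nat.strong_induction_on with
  | _ d IH =>
  have IHp : ∀ e < d, ∀ p : MvPolynomial (Fin n) K, p.totalDegree ≤ e → p ∈ staircaseSpan g e :=
    fun e he p hp => mem_of_monomial_mem _ e (IH e he) hp
  intro a
  -- Within one degree, exponents are compared lexicographically starting from the last variable.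
  induction hA : toLex (fun i => a (Fin.rev i)) using
    (wellFounded_lt (α := Lex (Fin n → ℕ))).induction generalizing a with
  | _ A IH2 =>
  subst hA
  intro had
  by_cases hstair : a ∈ staircase n
  · exact Submodule.subset_span ⟨a, had, staircaseProd_of_mem g hstair⟩
  simp only [staircase, Set.mem_ofPred_eq, not_forall, not_lt] at hstair
  obtain ⟨i, hi⟩ := hstair
  set m := n - (i : ℕ) with hm
  have hm0 : 1 ≤ m := by omega
  set b : Fin n →₀ ℕ := a - Finsupp.single i m with hb
  have hab : a = b + Finsupp.single i m := by
    rw [hb, tsub_add_cancel_of_le]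
    rwa [Finsupp.single_le_iff]
  have hbd : b.degree + m ≤ d := by
    have := had
    rw [hab, map_add, Finsupp.degree_single] at this
    exact this
  -- The complement of {0, …, i} has n - 1 - i = m - 1 elements, just few enough for the relation in
  -- degree m.
  set s : Finset (Fin n) := Finset.Iic i with hs
  have hcard : sᶜ.card < m := by
    rw [Finset.card_compl, hs, Fin.card_Iic, Fintype.card_fin]; omega
  have hrel := sum_esymm_mul_completeHomogeneous (R := K) s m hcard
  have hsingle : Finsupp.single i m ∈ s.finsuppAntidiag m := by
    rw [Finset.mem_finsuppAntidiag']
    refine ⟨by simp, ?_⟩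
    exact Finsupp.support_single_subset.trans (by simp [hs])
  have hh : completeHomogeneous K s m = monomial (Finsupp.single i m) 1 +
      ∑ l ∈ (s.finsuppAntidiag m).erase (Finsupp.single i m), monomial l 1 :=
    (Finset.add_sum_erase _ _ hsingle).symm
  have hant : Finset.HasAntidiagonal.antidiagonal m = insert (0, m) ((Finset.HasAntidiagonal.antidiagonal m).erase (0, m)) := by
    rw [Finset.insert_erase]; simp
  rw [hant, Finset.sum_insert (Finset.notMem_erase _ _)] at hrel
  simp only [pow_zero, esymm_zero, one_mul] at hrel
  -- The relation is multiplied by x^b and solved for the term x_i^m of h_m, with e_p written as g_p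
  -- - (g_p - e_p).
  have key : monomial a (1 : K) =
      - ∑ l ∈ (s.finsuppAntidiag m).erase (Finsupp.single i m), monomial (b + l) 1
      - ∑ p ∈ (Finset.HasAntidiagonal.antidiagonal m).erase (0, m), (-1 : K) ^ p.1 •
          (g p.1 * (monomial b 1 * completeHomogeneous K s p.2)
            - (g p.1 - esymm (Fin n) K p.1) * (monomial b 1 * completeHomogeneous K s p.2)) := by
    have e1 : ∀ l : Fin n →₀ ℕ, monomial (b + l) (1 : K) = monomial b 1 * monomial l 1 := by
      intro l; rw [monomial_mul, one_mul]
    have e2 : ∑ p ∈ (Finset.HasAntidiagonal.antidiagonal m).erase (0, m), (-1 : K) ^ p.1 •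
          (g p.1 * (monomial b 1 * completeHomogeneous K s p.2)
            - (g p.1 - esymm (Fin n) K p.1) * (monomial b 1 * completeHomogeneous K s p.2)) =
        monomial b 1 * ∑ p ∈ (Finset.HasAntidiagonal.antidiagonal m).erase (0, m),
          (-1) ^ p.1 * esymm (Fin n) K p.1 * completeHomogeneous K s p.2 := by
      rw [Finset.mul_sum]
      refine Finset.sum_congr rfl fun p _ => ?_
      rw [smul_eq_C_mul]
      simp only [map_pow, map_neg, map_one]
      ring
    rw [e2, hab, e1, Finset.sum_congr rfl fun l _ => e1 l, ← Finset.mul_sum]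
    linear_combination (monomial b (1 : K)) * hrel - (monomial b (1 : K)) * hh
  rw [key]
  refine sub_mem (neg_mem (Submodule.sum_mem _ fun l hl => ?_)) (Submodule.sum_mem _ fun p hp =>
    Submodule.smul_mem _ _ (sub_mem ?_ ?_))
  · rw [Finset.mem_erase, Finset.mem_finsuppAntidiag'] at hl
    obtain ⟨hne, hdeg, hsupp⟩ := hl
    have hdeg' : l.degree = m := hdeg
    have hli : l i < m := by
      have hle : l i ≤ m := hdeg' ▸ Finsupp.le_degree i l
      refine lt_of_le_of_ne hle fun h => hne ?_
      have h1 : Finsupp.single i m ≤ l := by rw [Finsupp.single_le_iff, h]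
      have h2 : (l - Finsupp.single i m).degree = 0 := by
        have h3 : l = (l - Finsupp.single i m) + Finsupp.single i m :=
          (tsub_add_cancel_of_le h1).symm
        have h4 := congrArg Finsupp.degree h3
        rw [map_add, Finsupp.degree_single] at h4
        omega
      rw [Finsupp.degree_eq_zero_iff] at h2
      exact le_antisymm (tsub_eq_zero_iff_le.mp h2) h1
    have hl0 : ∀ j, i < j → l j = 0 := by
      intro j hj
      by_contra h
      have := hsupp (Finsupp.mem_support_iff.mpr h)
      rw [hs, Finset.mem_Iic] at this
      exact absurd hj (not_lt.mpr this)
    -- Replacing x_i^m by x^l keeps the exponents beyond i and lowers the one at i.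
    refine IH2 _ ?_ (b + l) rfl ?_
    · refine ⟨Fin.rev i, fun j hj => ?_, ?_⟩
      · have hj' : i < Fin.rev j := by rwa [Fin.lt_rev_iff]
        rw [hab]
        simp [hl0 _ hj', Finsupp.single_eq_of_ne hj'.ne']
      · rw [hab]; simp [hli]
    · rw [map_add, hdeg']; exact hbd
  -- Here p ≥ 1. The cofactor of g_p has degree at most d - p, and the product with g_p - e_p has
  -- degree at most d - 1, so the induction on degree covers both.
  all_goals
    rw [Finset.mem_erase, Finset.HasAntidiagonal.mem_antidiagonal] at hp
    obtain ⟨hne, hsum⟩ := hp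
    have hp1 : 1 ≤ p.1 := by
      by_contra h
      apply hne
      ext <;> simp <;> omega
    have hpn : p.1 ≤ n := by omega
    have hdeg : (monomial b (1 : K) * completeHomogeneous K s p.2).totalDegree ≤ d - p.1 := by
      refine (totalDegree_mul _ _).trans ?_
      have h1 := totalDegree_monomial_le (R := K) b 1
      have h2 := totalDegree_completeHomogeneous_le (R := K) s p.2
      have h3 : (b.sum fun _ => id) = b.degree := rfl
      omega
  · have h := mul_mem_staircaseSpan g hp1 hpn (IHp (d - p.1) (by omega) _ hdeg)
    rwa [Nat.sub_add_cancel (by omega)] at h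
  · refine staircaseSpan_mono g (Nat.sub_le d 1) (IHp (d - 1) (by omega) _ ?_)
    refine (totalDegree_mul _ _).trans ?_
    have := hg p.1 hp1 hpn
    omega

/-- Dimension count: the products with exponent of degree at most d span a space containing all
polynomials of degree at most d, whose dimension equals the number of these products. -/
theorem linearIndependent_staircaseProd (g : ℕ → MvPolynomial (Fin n) K)
    (hg : ∀ j, 1 ≤ j → j ≤ n → (g j - esymm (Fin n) K j).totalDegree < j) :
    LinearIndependent K (staircaseProd g) := by
  rw [linearIndependent_iff_finset_linearIndependent]
  intro s
  set d := s.sup Finsupp.degree with hd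
  set A : Set (Fin n →₀ ℕ) := {a | a.degree ≤ d} with hA
  have hfin : A.Finite := by
    refine ((Set.Finite.pi' fun _ : Fin n => Set.finite_le_nat d).preimage
      DFunLike.coe_injective.injOn).subset fun a ha i => ?_
    exact (Finsupp.le_degree i a).trans ha
  have := hfin.fintype
  have hfam : LinearIndependent K (fun a : A => staircaseProd g a) := by
    rw [linearIndependent_iff_card_le_finrank_span]
    have hspan : Submodule.span K (Set.range fun a : A => staircaseProd g a) =
        staircaseSpan g d := by
      rw [staircaseSpan, Set.image_eq_range]
    have hle : restrictTotalDegree (Fin n) K d ≤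
        Submodule.span K (Set.range fun a : A => staircaseProd g a) := by
      rw [hspan]
      exact fun p hp => mem_of_monomial_mem _ d (monomial_mem_staircaseSpan g hg d)
        ((mem_restrictTotalDegree _ _ _).mp hp)
    have hfd : FiniteDimensional K
        (Submodule.span K (Set.range fun a : A => staircaseProd g a)) :=
      FiniteDimensional.span_of_finite K (Set.finite_range _)
    have h1 := Submodule.finrank_mono hle
    have h2 : Module.finrank K (restrictTotalDegree (Fin n) K d) = Fintype.card A :=
      Module.finrank_eq_card_basis (basisRestrictSupport K A)
    rw [← h2]
    exact h1
  exact hfam.comp (fun x : s => (⟨x, Finset.le_sup (f := Finsupp.degree) x.2⟩ : A))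
    fun x y h => Subtype.ext (congrArg (fun z : A => (z : Fin n →₀ ℕ)) h)

/-! ### The ideal in the adapted basis -/

theorem exists_add_single_of_notMem_staircase {a : Fin n →₀ ℕ} (ha : a ∉ staircase n) :
    ∃ (i : Fin n) (b : Fin n →₀ ℕ), a = b + Finsupp.single i (n - (i : ℕ)) := by
  simp only [staircase, Set.mem_ofPred_eq, not_forall, not_lt] at ha
  obtain ⟨i, hi⟩ := ha
  exact ⟨i, a - Finsupp.single i (n - (i : ℕ)),
    (tsub_add_cancel_of_le (Finsupp.single_le_iff.mpr hi)).symm⟩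

theorem staircaseProd_mem_ideal (g : ℕ → MvPolynomial (Fin n) K) {a : Fin n →₀ ℕ}
    (ha : a ∉ staircase n) :
    staircaseProd g a ∈ Ideal.span (Set.range fun i : Fin n => g (n - i)) := by
  obtain ⟨i, b, rfl⟩ := exists_add_single_of_notMem_staircase ha
  rw [← mul_staircaseProd]
  exact Ideal.mul_mem_right _ _ (Ideal.subset_span ⟨i, rfl⟩)

theorem span_staircaseProd_eq_top (g : ℕ → MvPolynomial (Fin n) K)
    (hg : ∀ j, 1 ≤ j → j ≤ n → (g j - esymm (Fin n) K j).totalDegree < j) :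
    Submodule.span K (Set.range (staircaseProd g)) = ⊤ := by
  refine eq_top_iff.mpr fun p _ => ?_
  have h := mem_of_monomial_mem _ p.totalDegree (monomial_mem_staircaseSpan g hg _) le_rfl
  exact Submodule.span_mono (Set.image_subset_range _ _) h

/-- A multiple of g_{n-i} is expanded by writing the cofactor in the spanning family; each term then
has its exponent at i raised by n - i, hence lies off the staircase. -/
theorem ideal_le_span_staircaseProd (g : ℕ → MvPolynomial (Fin n) K)
    (hg : ∀ j, 1 ≤ j → j ≤ n → (g j - esymm (Fin n) K j).totalDegree < j)
    {f : MvPolynomial (Fin n) K}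
    (hf : f ∈ Ideal.span (Set.range fun i : Fin n => g (n - i))) :
    f ∈ Submodule.span K (staircaseProd g '' (staircase n)ᶜ) := by
  induction hf using Submodule.span_induction with
  | mem x hx =>
    obtain ⟨i, rfl⟩ := hx
    refine Submodule.subset_span ⟨Finsupp.single i (n - (i : ℕ)), fun h => ?_, ?_⟩
    · simpa using h i
    · have h0 : staircaseProd g 0 = 1 := by simp [staircaseProd]
      rw [← zero_add (Finsupp.single i (n - (i : ℕ))), ← mul_staircaseProd, h0, mul_one]
  | zero => exact zero_mem _
  | add x y _ _ hx hy => exact add_mem hx hy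
  | smul c x hI hx =>
    clear hI
    induction hx using Submodule.span_induction with
    | zero => simp
    | add x y _ _ hx hy => rw [smul_add]; exact add_mem hx hy
    | smul r x _ hx => rw [smul_comm]; exact Submodule.smul_mem _ _ hx
    | mem x hx =>
      obtain ⟨a, ha, rfl⟩ := hx
      obtain ⟨i, b, rfl⟩ := exists_add_single_of_notMem_staircase ha
      have hmem : ∀ c : MvPolynomial (Fin n) K,
          g (n - i) * c ∈ Submodule.span K (staircaseProd g '' (staircase n)ᶜ) := by
        intro c
        have hc : c ∈ Submodule.span K (Set.range (staircaseProd g)) := by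
          rw [span_staircaseProd_eq_top g hg]; trivial
        induction hc using Submodule.span_induction with
        | zero => simp
        | add x y _ _ hx hy => rw [mul_add]; exact add_mem hx hy
        | smul r x _ hx => rw [mul_smul_comm]; exact Submodule.smul_mem _ _ hx
        | mem x hx =>
          obtain ⟨a, rfl⟩ := hx
          refine Submodule.subset_span ⟨_, fun h => ?_, (mul_staircaseProd g i a).symm⟩
          have := h i
          simp at this
      rw [← mul_staircaseProd, smul_eq_mul, mul_left_comm]
      exact hmem _

/-- The staircase monomials form a basis modulo an ideal generated by polynomials whose leading
forms are the elementary symmetric polynomials. -/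
theorem staircase_basis_mod (g : ℕ → MvPolynomial (Fin n) K)
    (hg : ∀ j, 1 ≤ j → j ≤ n → (g j - esymm (Fin n) K j).totalDegree < j)
    (I : Ideal (MvPolynomial (Fin n) K))
    (hI : I = Ideal.span (Set.range fun i : Fin n => g (n - i)))
    {ι : Type*} (e : ι → Fin n →₀ ℕ) (he : Function.Injective e)
    (hr : Set.range e = staircase n) :
    LinearIndependent K (fun i => Ideal.Quotient.mkₐ K I (monomial (e i) 1)) ∧
      Submodule.span K (Set.range fun i => Ideal.Quotient.mkₐ K I (monomial (e i) 1)) = ⊤ := by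
  subst hI
  set I := Ideal.span (Set.range fun i : Fin n => g (n - i))
  have hfun : (fun i => (monomial (e i) (1 : K))) = staircaseProd g ∘ e := by
    ext1 i
    exact (staircaseProd_of_mem g (hr ▸ Set.mem_range_self i)).symm
  have hind := linearIndependent_staircaseProd g hg
  have himg : Set.range (staircaseProd g ∘ e) = staircaseProd g '' staircase n := by
    rw [Set.range_comp, hr]
  constructor
  · have h1 : LinearIndependent K (fun i => (monomial (e i) (1 : K))) := by
      rw [hfun]; exact hind.comp e he
    refine h1.map (f := (Ideal.Quotient.mkₐ K I).toLinearMap) ?_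
    rw [hfun, himg]
    -- The kernel of the quotient map lies in the span of the off-staircase products, which by
    -- independence meets the span of the staircase monomials only in 0.
    refine (hind.disjoint_span_image (disjoint_compl_right (a := staircase n))).mono_right ?_
    intro f hf
    refine ideal_le_span_staircaseProd g hg ?_
    exact Ideal.Quotient.eq_zero_iff_mem.mp hf
  · rw [eq_top_iff]
    rintro x -
    obtain ⟨f, rfl⟩ := Ideal.Quotient.mkₐ_surjective K I x
    have hf : f ∈ Submodule.span K (Set.range (staircaseProd g)) := by
      rw [span_staircaseProd_eq_top g hg]; trivial
    induction hf using Submodule.span_induction with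
    | zero => simp
    | add x y _ _ hx hy => rw [map_add]; exact add_mem hx hy
    | smul r x _ hx => rw [map_smul]; exact Submodule.smul_mem _ _ hx
    | mem x hx =>
      obtain ⟨a, rfl⟩ := hx
      by_cases ha : a ∈ staircase n
      · rw [staircaseProd_of_mem g ha]
        obtain ⟨i, rfl⟩ := hr ▸ ha
        exact Submodule.subset_span ⟨i, rfl⟩
      · have h0 : Ideal.Quotient.mkₐ K I (staircaseProd g a) = 0 :=
          Ideal.Quotient.eq_zero_iff_mem.mpr (staircaseProd_mem_ideal g ha)
        rw [h0]; exact zero_mem _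

end Staircase

/-! ### The codes of the permutations -/

theorem code_lt {n : ℕ} (w : Equiv.Perm (Fin n)) (i : Fin n) : code w i < n - i := by
  have h : (Finset.univ.filter fun j => i < j ∧ w j < w i) ⊆ Finset.Ioi i := by
    intro j hj
    simp only [Finset.mem_filter] at hj
    exact Finset.mem_Ioi.mpr hj.2.1
  have h2 := Finset.card_le_card h
  rw [Fin.card_Ioi] at h2
  unfold code
  omega

theorem code_eq_card_values {n : ℕ} (w : Equiv.Perm (Fin n)) (i : Fin n) :
    code w i = (Finset.univ.filter fun y => i < w.symm y ∧ y < w i).card := by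
  rw [code, ← Finset.card_map w.toEmbedding]
  congr 1
  ext y
  simp only [Finset.mem_map, Finset.mem_filter, Finset.mem_univ, true_and,
    Equiv.coe_toEmbedding]
  constructor
  · rintro ⟨j, h, rfl⟩; simpa using h
  · intro h; exact ⟨w.symm y, by simpa using h, by simp⟩

/-- At the first index i where v and w differ, say v i < w i. Every value counted by the code of v
at i is also counted for w, because the earlier values agree; the value v i is counted for w only.
So the codes differ at i. -/
theorem code_injective {n : ℕ} : Function.Injective (code : Equiv.Perm (Fin n) → Fin n → ℕ) := by
  intro v w h
  have main : ∀ (v w : Equiv.Perm (Fin n)) (i : Fin n), code v = code w →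
      (∀ j < i, v j = w j) → ¬ v i < w i := by
    intro v w i h hj hlt
    have hc := congrFun h i
    rw [code_eq_card_values, code_eq_card_values] at hc
    have key : ∀ y : Fin n, y < w i → (i < v.symm y → i < w.symm y) := by
      intro y hy hv
      by_contra hw
      rcases (not_lt.mp hw).lt_or_eq with h1 | h1
      · have h2 := hj _ h1
        rw [Equiv.apply_symm_apply, ← Equiv.eq_symm_apply] at h2
        rw [h2] at h1
        exact absurd hv (not_lt.mpr h1.le)
      · rw [← h1, Equiv.apply_symm_apply] at hy
        exact lt_irrefl _ hy
    have hi : i < w.symm (v i) := by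
      by_contra hw
      rcases (not_lt.mp hw).lt_or_eq with h1 | h1
      · have h2 := hj _ h1
        rw [Equiv.apply_symm_apply] at h2
        exact h1.ne (v.injective h2)
      · rw [Equiv.symm_apply_eq] at h1
        exact hlt.ne h1
    refine (Finset.card_lt_card ?_).ne hc
    rw [Finset.ssubset_iff_of_subset]
    · exact ⟨v i, by simpa using ⟨hi, hlt⟩, by simp⟩
    · intro y hy
      simp only [Finset.mem_filter, Finset.mem_univ, true_and] at hy ⊢
      exact ⟨key y (hy.2.trans hlt) hy.1, hy.2.trans hlt⟩
  have heq : ∀ i, v i = w i := by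
    intro i
    induction i using WellFoundedLT.induction with
    | _ i ih =>
    exact le_antisymm (not_lt.mp (main w v i h.symm fun j hj => (ih j hj).symm))
      (not_lt.mp (main v w i h ih))
  exact Equiv.ext heq

/-- Injectivity suffices, since the admissible sequences number ∏ (n - i) = n!. -/
theorem exists_code_eq {n : ℕ} (a : Fin n → ℕ) (ha : ∀ i : Fin n, a i < n - i) :
    ∃ w : Equiv.Perm (Fin n), code w = a := by
  let F : Equiv.Perm (Fin n) → ∀ i : Fin n, Fin (n - i) := fun w i => ⟨code w i, code_lt w i⟩
  have hF : Function.Injective F := by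
    intro v w h
    refine code_injective (funext fun i => ?_)
    exact congrArg Fin.val (congrFun h i)
  have hcard : Fintype.card (Equiv.Perm (Fin n)) = Fintype.card (∀ i : Fin n, Fin (n - i)) := by
    rw [Fintype.card_perm, Fintype.card_fin, Fintype.card_pi]
    simp only [Fintype.card_fin]
    rw [Fin.prod_univ_eq_prod_range (fun i => n - i) n, ← Finset.prod_range_reflect,
      ← Finset.prod_range_add_one_eq_factorial]
    refine Finset.prod_congr rfl fun i hi => ?_
    rw [Finset.mem_range] at hi
    omega
  obtain ⟨w, hw⟩ := ((Fintype.bijective_iff_injective_and_card F).mpr ⟨hF, hcard⟩).2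
    fun i => ⟨a i, ha i⟩
  exact ⟨w, funext fun i => congrArg Fin.val (congrFun hw i)⟩

/-! ### Leading forms of the quantum elementary symmetric polynomials -/

/-- The polynomials in `t` over `R[x]` of total degree at most `d` in `x` and `t` together. -/
def jointDegreeLE {σ R : Type*} [CommRing R] (d : ℕ) :
    Submodule R (Polynomial (MvPolynomial σ R)) where
  carrier := {f | ∀ k, ∀ c ∈ (f.coeff k).support, c.degree + k ≤ d}
  zero_mem' := by simp
  add_mem' := by
    classical
    intro f g hf hg k c hc
    rw [Polynomial.coeff_add] at hc
    rcases Finset.mem_union.mp (support_add hc) with h | h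
    · exact hf k c h
    · exact hg k c h
  smul_mem' := by
    intro r f hf k c hc
    rw [Polynomial.coeff_smul] at hc
    exact hf k c (support_smul hc)

theorem jointDegreeLE_mono {σ R : Type*} [CommRing R] {d e : ℕ} (h : d ≤ e) :
    jointDegreeLE (σ := σ) (R := R) d ≤ jointDegreeLE e :=
  fun _ hf k c hc => (hf k c hc).trans h

theorem mul_mem_jointDegreeLE {σ R : Type*} [CommRing R] {d e : ℕ}
    {f g : Polynomial (MvPolynomial σ R)} (hf : f ∈ jointDegreeLE d) (hg : g ∈ jointDegreeLE e) :
    f * g ∈ jointDegreeLE (d + e) := by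
  classical
  intro k c hc
  rw [Polynomial.coeff_mul] at hc
  obtain ⟨p, hp, hc⟩ := Finset.mem_biUnion.mp (support_sum hc)
  rw [Finset.HasAntidiagonal.mem_antidiagonal] at hp
  obtain ⟨a, ha, b, hb, rfl⟩ := Finset.mem_add.mp (support_mul _ _ hc)
  have h1 := hf _ a ha
  have h2 := hg _ b hb
  rw [map_add]
  omega

theorem C_C_mem_jointDegreeLE {σ R : Type*} [CommRing R] (r : R) :
    (Polynomial.C (C r) : Polynomial (MvPolynomial σ R)) ∈ jointDegreeLE 0 := by
  classical
  intro k c hc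
  rw [Polynomial.coeff_C] at hc
  by_cases hk : k = 0
  · subst hk
    rw [if_pos rfl, mem_support_iff, coeff_C] at hc
    by_cases h : 0 = c
    · simp [← h]
    · simp [h] at hc
  · rw [if_neg hk] at hc; simp at hc

theorem prod_mem_jointDegreeLE {σ R ι : Type*} [CommRing R] (s : Finset ι) (d : ι → ℕ)
    (f : ι → Polynomial (MvPolynomial σ R)) (h : ∀ i ∈ s, f i ∈ jointDegreeLE (d i)) :
    ∏ i ∈ s, f i ∈ jointDegreeLE (∑ i ∈ s, d i) := by
  classical
  induction s using Finset.induction_on with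
  | empty => simpa using C_C_mem_jointDegreeLE (σ := σ) (1 : R)
  | insert i s hi ih =>
    rw [Finset.prod_insert hi, Finset.sum_insert hi]
    exact mul_mem_jointDegreeLE (h i (Finset.mem_insert_self _ _))
      (ih fun j hj => h j (Finset.mem_insert_of_mem hj))

theorem C_X_add_X_mem_jointDegreeLE {σ R : Type*} [CommRing R] (i : σ) :
    (Polynomial.C (X i) + Polynomial.X : Polynomial (MvPolynomial σ R)) ∈ jointDegreeLE 1 := by
  classical
  refine add_mem (fun k c hc => ?_) (fun k c hc => ?_)
  · rw [Polynomial.coeff_C] at hc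
    by_cases hk : k = 0
    · subst hk
      rw [if_pos rfl] at hc
      have := (Finset.mem_singleton.mp ((support_monomial_subset) hc))
      simp [this]
    · rw [if_neg hk] at hc; simp at hc
  · rw [Polynomial.coeff_X] at hc
    by_cases hk : 1 = k
    · subst hk
      rw [if_pos rfl, mem_support_iff, coeff_one] at hc
      by_cases h : 0 = c
      · simp [← h]
      · simp [h] at hc
    · rw [if_neg hk] at hc; simp at hc

theorem coeff_prod_C_X_add_X (n : ℕ) (R : Type*) [CommRing R] (j : ℕ) (hj : j ≤ n) :
    (∏ i : Fin n, (Polynomial.C (X i : MvPolynomial (Fin n) R) + Polynomial.X)).coeff (n - j) =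
      esymm (Fin n) R j := by
  have h := MvPolynomial.prod_X_add_C_coeff R (Fin n) (n - j) (by simp)
  rw [Fintype.card_fin, Nat.sub_sub_self hj] at h
  rw [← h]
  exact congrArg (fun f => Polynomial.coeff f (n - j))
    (Finset.prod_congr rfl fun i _ => add_comm _ _)

/-- The terms of `Δ_n` other than the product of the diagonal entries. -/
theorem exists_Delta_eq_prod_add (n : ℕ) : ∃ r ∈ jointDegreeLE (σ := Fin n) (R := QRing n) (n - 1),
    Delta n n Polynomial.C Polynomial.X =
      ∏ i : Fin n, (Polynomial.C (X i : QPoly n) + Polynomial.X) + r := by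
  classical
  have hx : ∀ j : Fin n, xVar n j = X j := fun j => by simp [xVar]
  let f : Fin n → Fin n → Polynomial (QPoly n) := fun i j =>
    if i = j then Polynomial.C (xVar n i) + Polynomial.X
    else if (j : ℕ) = i + 1 then Polynomial.C (qVar n i)
    else if (i : ℕ) = j + 1 then -1 else 0
  have hD : Delta n n Polynomial.C Polynomial.X =
      ∑ σ : Equiv.Perm (Fin n), Equiv.Perm.sign σ • ∏ j, f (σ j) j := by
    rw [Delta, Matrix.det_apply]; rfl
  have hone : Equiv.Perm.sign (1 : Equiv.Perm (Fin n)) •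
      ∏ j, f ((1 : Equiv.Perm (Fin n)) j) j =
      ∏ i : Fin n, (Polynomial.C (X i : QPoly n) + Polynomial.X) := by
    simp [f, hx]
  rw [hD, ← Finset.add_sum_erase _ _ (Finset.mem_univ 1), hone]
  refine ⟨_, ?_, rfl⟩
  refine Submodule.sum_mem _ fun σ hσ => ?_
  have hσ1 : σ ≠ 1 := Finset.ne_of_mem_erase hσ
  -- Only diagonal entries carry degree, as the q_i are constants in x and t. The degree is thus
  -- bounded by the number of fixed points, at most n - 1 when σ ≠ 1.
  have hmem : ∏ j : Fin n, f (σ j) j ∈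
      jointDegreeLE (σ := Fin n) (R := QRing n) (∑ j, if σ j = j then 1 else 0) := by
    refine prod_mem_jointDegreeLE _ _ _ fun j _ => ?_
    simp only [f]
    by_cases h : σ j = j
    · rw [if_pos h, if_pos h, hx]; exact C_X_add_X_mem_jointDegreeLE _
    rw [if_neg h, if_neg h]
    split_ifs with h1 h2
    · unfold qVar
      split_ifs
      · exact C_C_mem_jointDegreeLE _
      · simp
    · exact neg_mem (by simpa using C_C_mem_jointDegreeLE (σ := Fin n) (1 : QRing n))
    · exact zero_mem _
  have hle : (∑ j, if σ j = j then 1 else 0) ≤ n - 1 := by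
    rw [← Finset.card_filter]
    obtain ⟨j, hj⟩ : ∃ j, σ j ≠ j := by
      by_contra h
      push Not at h
      exact hσ1 (Equiv.ext h)
    have : (Finset.univ.filter fun j => σ j = j) ⊆ Finset.univ.erase j := by
      intro k hk
      simp only [Finset.mem_filter] at hk
      refine Finset.mem_erase.mpr ⟨?_, Finset.mem_univ _⟩
      rintro rfl
      exact hj hk.2
    simpa using Finset.card_le_card this
  have := jointDegreeLE_mono hle hmem
  rcases Int.units_eq_one_or (Equiv.Perm.sign σ) with h | h <;> rw [h]
  · simpa using this
  · simpa using neg_mem this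

/-- `quantumE` and the elementary symmetric polynomial differ by terms of lower degree. -/
theorem degree_lt_of_mem_support_quantumE_sub (n : ℕ) (i : Fin n) :
    ∀ c ∈ (quantumE n i - esymm (Fin n) (QRing n) (i + 1)).support, c.degree < i + 1 := by
  obtain ⟨r, hr, h⟩ := exists_Delta_eq_prod_add n
  rw [quantumE, h, Polynomial.coeff_add, coeff_prod_C_X_add_X n (QRing n) (i + 1) i.2,
    add_sub_cancel_left]
  intro c hc
  have := hr _ c hc
  omega

theorem totalDegree_polyToField_quantumE_sub_lt (n : ℕ) (i : Fin n) :
    (polyToField n (quantumE n i) - esymm (Fin n) (SeriesField n) (i + 1)).totalDegree <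
      i + 1 := by
  rw [polyToField, ← map_esymm (Fin n) (QRing n), ← map_sub]
  refine Nat.lt_succ_iff.mpr (Finset.sup_le fun c hc => ?_)
  exact Nat.lt_succ_iff.mp
    (degree_lt_of_mem_support_quantumE_sub n i c (support_map_subset _ _ hc))

/-! ### The derivations `∂/∂t_u` -/

/-- The quotient rule does not depend on the representation of z as a fraction: differentiate the
cross relation a b' = a' b. The form without denominators lets the sum and product rules be checked
over a common denominator. -/
theorem dt_mul_sq {n : ℕ} (u : Equiv.Perm (Fin n)) {z : SeriesField n} {a b : SeriesRing n}
    (h : z * algebraMap _ (SeriesField n) b = algebraMap _ _ a) :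
    dt u z * algebraMap _ (SeriesField n) b ^ 2 =
      algebraMap _ (SeriesField n) (MvPowerSeries.pderiv ℚ (Sum.inr u) a * b -
        a * MvPowerSeries.pderiv ℚ (Sum.inr u) b) := by
  obtain ⟨a', b', hz, hd⟩ : ∃ (a' : SeriesRing n) (b' : nonZeroDivisors (SeriesRing n)),
      z * algebraMap _ (SeriesField n) (b' : SeriesRing n) = algebraMap _ _ a' ∧
      dt u z = algebraMap _ (SeriesField n)
        (MvPowerSeries.pderiv ℚ (Sum.inr u) a' * b' -
          a' * MvPowerSeries.pderiv ℚ (Sum.inr u) (b' : SeriesRing n)) /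
        algebraMap _ (SeriesField n) ((b' : SeriesRing n) ^ 2) :=
    ⟨_, _, IsLocalization.sec_spec (nonZeroDivisors (SeriesRing n)) z, rfl⟩
  have hinj : Function.Injective (algebraMap (SeriesRing n) (SeriesField n)) :=
    IsFractionRing.injective _ _
  have hb' : algebraMap (SeriesRing n) (SeriesField n) (b' : SeriesRing n) ≠ 0 := by
    rw [Ne, map_eq_zero_iff _ hinj]
    exact nonZeroDivisors.ne_zero b'.2
  have hab : a * (b' : SeriesRing n) = a' * b := by
    apply hinj
    rw [map_mul, map_mul, ← h, ← hz]
    ring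
  have hD := congrArg (MvPowerSeries.pderiv ℚ (Sum.inr u)) hab
  simp only [Derivation.leibniz, smul_eq_mul] at hD
  rw [hd, map_pow, div_mul_eq_mul_div, div_eq_iff (pow_ne_zero 2 hb'), ← map_pow, ← map_pow,
    ← map_mul, ← map_mul]
  congr 1
  linear_combination (-(b : SeriesRing n) * b') * hD +
    (b * MvPowerSeries.pderiv ℚ (Sum.inr u) (b' : SeriesRing n) +
      b' * MvPowerSeries.pderiv ℚ (Sum.inr u) b) * hab

theorem exists_mul_algebraMap_eq {n : ℕ} (z : SeriesField n) : ∃ a b : SeriesRing n, b ≠ 0 ∧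
    z * algebraMap _ (SeriesField n) b = algebraMap _ _ a := by
  obtain ⟨⟨a, b⟩, h⟩ := IsLocalization.surj (nonZeroDivisors (SeriesRing n)) z
  exact ⟨a, b, nonZeroDivisors.ne_zero b.2, h⟩

theorem algebraMap_series_ne_zero {n : ℕ} {b : SeriesRing n} (hb : b ≠ 0) :
    algebraMap (SeriesRing n) (SeriesField n) b ≠ 0 := by
  rwa [Ne, map_eq_zero_iff _ (IsFractionRing.injective (SeriesRing n) (SeriesField n))]

theorem dt_algebraMap {n : ℕ} (u : Equiv.Perm (Fin n)) (a : SeriesRing n) :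
    dt u (algebraMap _ (SeriesField n) a) =
      algebraMap _ (SeriesField n) (MvPowerSeries.pderiv ℚ (Sum.inr u) a) := by
  have h := dt_mul_sq u (z := algebraMap _ (SeriesField n) a) (a := a) (b := 1) (by simp)
  simpa using h

theorem dt_add {n : ℕ} (u : Equiv.Perm (Fin n)) (y z : SeriesField n) :
    dt u (y + z) = dt u y + dt u z := by
  obtain ⟨a, b, hb, h⟩ := exists_mul_algebraMap_eq y
  obtain ⟨a', b', hb', h'⟩ := exists_mul_algebraMap_eq z
  have hs : (y + z) * algebraMap _ (SeriesField n) (b * b') =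
      algebraMap _ _ (a * b' + a' * b) := by
    rw [map_add, map_mul, map_mul, map_mul, ← h, ← h']; ring
  have h0 := pow_ne_zero 2 (algebraMap_series_ne_zero (mul_ne_zero hb hb'))
  have e := dt_mul_sq u h
  have e' := dt_mul_sq u h'
  have es := dt_mul_sq u hs
  apply mul_right_cancel₀ h0
  rw [es]
  simp only [map_add, map_sub, map_mul, Derivation.leibniz, smul_eq_mul] at e e' ⊢
  linear_combination -(algebraMap _ (SeriesField n) b') ^ 2 * e -
    (algebraMap _ (SeriesField n) b) ^ 2 * e'

theorem dt_mul {n : ℕ} (u : Equiv.Perm (Fin n)) (y z : SeriesField n) :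
    dt u (y * z) = dt u y * z + y * dt u z := by
  obtain ⟨a, b, hb, h⟩ := exists_mul_algebraMap_eq y
  obtain ⟨a', b', hb', h'⟩ := exists_mul_algebraMap_eq z
  have hs : (y * z) * algebraMap _ (SeriesField n) (b * b') = algebraMap _ _ (a * a') := by
    rw [map_mul, map_mul, ← h, ← h']; ring
  have h0 := pow_ne_zero 2 (algebraMap_series_ne_zero (mul_ne_zero hb hb'))
  have e := dt_mul_sq u h
  have e' := dt_mul_sq u h'
  have es := dt_mul_sq u hs
  apply mul_right_cancel₀ h0
  rw [es]
  simp only [map_sub, map_mul, map_add, Derivation.leibniz, smul_eq_mul, ← h, ← h'] at e e' ⊢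
  linear_combination -(z * algebraMap _ (SeriesField n) b' ^ 2) * e -
    (y * algebraMap _ (SeriesField n) b ^ 2) * e'

theorem dt_zero {n : ℕ} (u : Equiv.Perm (Fin n)) : dt u (0 : SeriesField n) = 0 := by
  simpa using dt_algebraMap u (0 : SeriesRing n)

theorem pderiv_qToSeries {n : ℕ} (u : Equiv.Perm (Fin n)) (p : QRing n) :
    MvPowerSeries.pderiv ℚ (Sum.inr u) (qToSeries n p) = 0 := by
  induction p using MvPolynomial.induction_on with
  | C a => simp [qToSeries]
  | add p r hp hr => rw [map_add, map_add, hp, hr, add_zero]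
  | mul_X p k hp =>
    rw [map_mul, Derivation.leibniz, hp]
    simp [qToSeries, MvPowerSeries.pderiv_X_of_ne]

/-! ### The coefficientwise derivation of k[x] -/

theorem coeff_dtPoly {n : ℕ} (u : Equiv.Perm (Fin n)) (f : MvPolynomial (Fin n) (SeriesField n))
    (m : Fin n →₀ ℕ) : (dtPoly u f).coeff m = dt u (f.coeff m) := by
  classical
  rw [dtPoly, coeff_sum]
  simp only [coeff_monomial]
  rw [Finset.sum_ite_eq']
  split_ifs with h
  · rfl
  · rw [notMem_support_iff.mp h, dt_zero]

theorem dtPoly_add {n : ℕ} (u : Equiv.Perm (Fin n)) (f g : MvPolynomial (Fin n) (SeriesField n)) :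
    dtPoly u (f + g) = dtPoly u f + dtPoly u g := by
  ext m
  simp only [coeff_dtPoly, coeff_add, dt_add]

/-- `dt` as an additive map. -/
def dtHom {n : ℕ} (u : Equiv.Perm (Fin n)) : SeriesField n →+ SeriesField n :=
  ⟨⟨dt u, dt_zero u⟩, dt_add u⟩

/-- `dtPoly` as an additive map. -/
def dtPolyHom {n : ℕ} (u : Equiv.Perm (Fin n)) :
    MvPolynomial (Fin n) (SeriesField n) →+ MvPolynomial (Fin n) (SeriesField n) :=
  ⟨⟨dtPoly u, by simp [dtPoly]⟩, dtPoly_add u⟩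

theorem dtPoly_sum {n : ℕ} {ι : Type*} (u : Equiv.Perm (Fin n)) (s : Finset ι)
    (f : ι → MvPolynomial (Fin n) (SeriesField n)) :
    dtPoly u (∑ i ∈ s, f i) = ∑ i ∈ s, dtPoly u (f i) :=
  map_sum (dtPolyHom u) f s

theorem dtPoly_sub {n : ℕ} (u : Equiv.Perm (Fin n)) (f g : MvPolynomial (Fin n) (SeriesField n)) :
    dtPoly u (f - g) = dtPoly u f - dtPoly u g :=
  map_sub (dtPolyHom u) f g

theorem dtPoly_mul {n : ℕ} (u : Equiv.Perm (Fin n)) (f g : MvPolynomial (Fin n) (SeriesField n)) :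
    dtPoly u (f * g) = dtPoly u f * g + f * dtPoly u g := by
  ext m
  simp only [coeff_dtPoly, coeff_add, coeff_mul]
  rw [← Finset.sum_add_distrib]
  refine (map_sum (dtHom u) _ _).trans (Finset.sum_congr rfl fun p _ => ?_)
  exact dt_mul u _ _

theorem dtPoly_C {n : ℕ} (u : Equiv.Perm (Fin n)) (z : SeriesField n) :
    dtPoly u (C z) = C (dt u z) := by
  classical
  ext m
  rw [coeff_dtPoly, coeff_C, coeff_C]
  split_ifs
  · rfl
  · exact dt_zero u

theorem dtPoly_polyToField {n : ℕ} (u : Equiv.Perm (Fin n)) (p : QPoly n) :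
    dtPoly u (polyToField n p) = 0 := by
  ext m
  rw [coeff_dtPoly, polyToField, coeff_map, RingHom.comp_apply, dt_algebraMap, pderiv_qToSeries,
    map_zero, coeff_zero]

theorem dtPoly_codeMonomial {n : ℕ} (u w : Equiv.Perm (Fin n)) :
    dtPoly u (codeMonomial w) = 0 := by
  have h : codeMonomial w = polyToField n (∏ i, X i ^ code w i) := by
    simp [codeMonomial, polyToField]
  rw [h, dtPoly_polyToField]

theorem fieldIdeal_eq_span (n : ℕ) :
    fieldIdeal n = Ideal.span (Set.range fun i => polyToField n (quantumE n i)) := by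
  rw [fieldIdeal, quantumIdeal, Ideal.map_span, ← Set.range_comp]
  rfl

/-- The generators have coefficients in ℤ[q], so they are killed by ∂/∂t_u, and the Leibniz rule
does the rest. -/
theorem dtPoly_mem_fieldIdeal {n : ℕ} (u : Equiv.Perm (Fin n))
    {f : MvPolynomial (Fin n) (SeriesField n)} (hf : f ∈ fieldIdeal n) :
    dtPoly u f ∈ fieldIdeal n := by
  have hf' := hf
  rw [fieldIdeal_eq_span] at hf'
  induction hf' using Submodule.span_induction with
  | mem x hx => obtain ⟨i, rfl⟩ := hx; rw [dtPoly_polyToField]; exact zero_mem _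
  | zero => rw [← C_0, dtPoly_C, dt_zero, C_0]; exact zero_mem _
  | add x y hx0 hy0 hx hy =>
    replace hx0 : x ∈ fieldIdeal n := fieldIdeal_eq_span n ▸ hx0
    replace hy0 : y ∈ fieldIdeal n := fieldIdeal_eq_span n ▸ hy0
    rw [dtPoly_add]; exact add_mem (hx hx0) (hy hy0)
  | smul c x hx0 hx =>
    replace hx0 : x ∈ fieldIdeal n := fieldIdeal_eq_span n ▸ hx0
    rw [smul_eq_mul, dtPoly_mul]
    exact add_mem (Ideal.mul_mem_left _ _ hx0) (Ideal.mul_mem_left _ _ (hx hx0))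

/-! ### The orthogonalized monomials form a basis -/

theorem codeMonomial_eq_monomial {n : ℕ} (w : Equiv.Perm (Fin n)) :
    codeMonomial w = monomial (Finsupp.equivFunOnFinite.symm (code w)) 1 := by
  rw [monomial_eq, C_1, one_mul, Finsupp.prod_fintype _ _ (by simp)]
  rfl

theorem codeMonomial_basis_mod (n : ℕ) :
    LinearIndependent (SeriesField n) (fun w : Equiv.Perm (Fin n) =>
      Ideal.Quotient.mkₐ (SeriesField n) (fieldIdeal n) (codeMonomial w)) ∧
    Submodule.span (SeriesField n) (Set.range fun w : Equiv.Perm (Fin n) =>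
      Ideal.Quotient.mkₐ (SeriesField n) (fieldIdeal n) (codeMonomial w)) = ⊤ := by
  -- `quantumE` counts from 0, whence the shift by one; only the values with 1 ≤ j ≤ n matter.
  let g : ℕ → MvPolynomial (Fin n) (SeriesField n) := fun j =>
    if h : j - 1 < n then polyToField n (quantumE n ⟨j - 1, h⟩) else 0
  have hg : ∀ j, 1 ≤ j → j ≤ n → (g j - esymm (Fin n) (SeriesField n) j).totalDegree < j := by
    intro j h1 hj
    have h := totalDegree_polyToField_quantumE_sub_lt n ⟨j - 1, by omega⟩
    simp only [Nat.sub_add_cancel h1] at h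
    simpa only [g, dif_pos (show j - 1 < n by omega)] using h
  have hI : fieldIdeal n = Ideal.span (Set.range fun i : Fin n => g (n - i)) := by
    rw [fieldIdeal_eq_span, ← Fin.revPerm.surjective.range_comp]
    congr 2
    ext1 i
    have h : n - (i : ℕ) - 1 < n := by omega
    simp only [g, dif_pos h, Function.comp_apply, Fin.revPerm_apply]
    have e : Fin.rev i = ⟨n - (i : ℕ) - 1, h⟩ := by
      ext; simp only [Fin.val_rev]; omega
    rw [e]
  simp only [codeMonomial_eq_monomial]
  refine staircase_basis_mod g hg _ hI _
    (Finsupp.equivFunOnFinite.symm.injective.comp code_injective) ?_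
  ext a
  constructor
  · rintro ⟨w, rfl⟩ i
    exact code_lt w i
  · intro ha
    obtain ⟨w, hw⟩ := exists_code_eq a ha
    refine ⟨w, ?_⟩
    simp only [hw]
    exact Finsupp.equivFunOnFinite.symm_apply_apply a

/-- The Gram–Schmidt recursion is read backwards. This is valid for arbitrary coefficients,
including the value 0 that division yields should some ⟨X_v, X_v⟩ vanish. -/
theorem codeMonomial_mem_span_gramSchmidtX {n : ℕ} (w : Equiv.Perm (Fin n)) :
    codeMonomial w ∈ Submodule.span (SeriesField n) (Set.range (gramSchmidtX (n := n))) := by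
  have h := gramSchmidtX.eq_1 w
  rw [eq_sub_iff_add_eq] at h
  rw [← h]
  refine add_mem (Submodule.subset_span ⟨w, rfl⟩) (Submodule.sum_mem _ fun v _ => ?_)
  split_ifs
  · rw [← smul_eq_C_mul]
    exact Submodule.smul_mem _ _ (Submodule.subset_span ⟨v, rfl⟩)
  · exact zero_mem _

theorem gramSchmidtX_mem_span_codeMonomial {n : ℕ} (w : Equiv.Perm (Fin n)) :
    gramSchmidtX w ∈ Submodule.span (SeriesField n) (Set.range (codeMonomial (n := n))) := by
  induction hA : toLex (code w) using
    (wellFounded_lt (α := Lex (Fin n → ℕ))).induction generalizing w with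
  | _ A IH =>
  subst hA
  rw [gramSchmidtX.eq_1]
  refine sub_mem (Submodule.subset_span ⟨w, rfl⟩) (Submodule.sum_mem _ fun v _ => ?_)
  split_ifs with h
  · rw [← smul_eq_C_mul]
    exact Submodule.smul_mem _ _ (IH _ h v rfl)
  · exact zero_mem _

/-- The orthogonalized monomials form a basis modulo the ideal. -/
theorem gramSchmidtX_basis_mod (n : ℕ) :
    LinearIndependent (SeriesField n) (fun w : Equiv.Perm (Fin n) =>
      Ideal.Quotient.mkₐ (SeriesField n) (fieldIdeal n) (gramSchmidtX w)) ∧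
    Submodule.span (SeriesField n) (Set.range fun w : Equiv.Perm (Fin n) =>
      Ideal.Quotient.mkₐ (SeriesField n) (fieldIdeal n) (gramSchmidtX w)) = ⊤ := by
  obtain ⟨hi, hs⟩ := codeMonomial_basis_mod n
  have hspan : Submodule.span (SeriesField n) (Set.range fun w : Equiv.Perm (Fin n) =>
      Ideal.Quotient.mkₐ (SeriesField n) (fieldIdeal n) (gramSchmidtX w)) = ⊤ := by
    rw [eq_top_iff, ← hs, Submodule.span_le]
    rintro _ ⟨w, rfl⟩
    have h := Submodule.mem_map_of_mem
      (f := (Ideal.Quotient.mkₐ (SeriesField n) (fieldIdeal n)).toLinearMap)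
      (codeMonomial_mem_span_gramSchmidtX w)
    rw [Submodule.map_span, ← Set.range_comp] at h
    exact h
  -- A spanning family with as many members as the basis of code monomials is independent.
  refine ⟨linearIndependent_of_top_le_span_of_card_eq_finrank hspan.ge ?_, hspan⟩
  exact (Module.finrank_eq_card_basis (Module.Basis.mk hi hs.ge)).symm

theorem eq_zero_of_sum_mem_fieldIdeal {n : ℕ} (c : Equiv.Perm (Fin n) → SeriesField n)
    (h : ∑ u, C (c u) * gramSchmidtX u ∈ fieldIdeal n) : c = 0 := by
  have h0 : ∑ u, c u • Ideal.Quotient.mkₐ (SeriesField n) (fieldIdeal n) (gramSchmidtX u) = 0 := by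
    simp only [← map_smul, ← map_sum, smul_eq_C_mul]
    exact Ideal.Quotient.eq_zero_iff_mem.mpr h
  exact funext (Fintype.linearIndependent_iff.mp (gramSchmidtX_basis_mod n).1 c h0)

theorem exists_sub_sum_mem_fieldIdeal {n : ℕ} (f : MvPolynomial (Fin n) (SeriesField n)) :
    ∃ c : Equiv.Perm (Fin n) → SeriesField n,
      f - ∑ u, C (c u) * gramSchmidtX u ∈ fieldIdeal n := by
  have h : Ideal.Quotient.mkₐ (SeriesField n) (fieldIdeal n) f ∈
      Submodule.span (SeriesField n) (Set.range fun w : Equiv.Perm (Fin n) =>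
        Ideal.Quotient.mkₐ (SeriesField n) (fieldIdeal n) (gramSchmidtX w)) := by
    rw [(gramSchmidtX_basis_mod n).2]; trivial
  obtain ⟨c, hc⟩ := (Submodule.mem_span_range_iff_exists_fun _).mp h
  refine ⟨c, Ideal.Quotient.eq.mp ?_⟩
  simp only [← map_smul, ← map_sum, smul_eq_C_mul] at hc
  exact hc.symm

/-- Differentiation acts only on the coefficients of the code monomials and so stays in their span.
Hence the expansion is an equality of polynomials, not merely a congruence. -/
theorem exists_dtPoly_eq_sum {n : ℕ} (u : Equiv.Perm (Fin n))
    {f : MvPolynomial (Fin n) (SeriesField n)}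
    (hf : f ∈ Submodule.span (SeriesField n) (Set.range (codeMonomial (n := n)))) :
    ∃ c : Equiv.Perm (Fin n) → SeriesField n, dtPoly u f = ∑ v, C (c v) * gramSchmidtX v := by
  have hmem : dtPoly u f ∈
      Submodule.span (SeriesField n) (Set.range (gramSchmidtX (n := n))) := by
    obtain ⟨c, rfl⟩ := (Submodule.mem_span_range_iff_exists_fun _).mp hf
    rw [dtPoly_sum]
    refine Submodule.sum_mem _ fun w _ => ?_
    rw [smul_eq_C_mul, dtPoly_mul, dtPoly_C, dtPoly_codeMonomial, mul_zero, add_zero,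
      ← smul_eq_C_mul]
    exact Submodule.smul_mem _ _ (codeMonomial_mem_span_gramSchmidtX w)
  obtain ⟨c, hc⟩ := (Submodule.mem_span_range_iff_exists_fun _).mp hmem
  exact ⟨c, by simp only [← smul_eq_C_mul, hc]⟩

/-! ### The Lax equation -/

theorem existsUnique_isMulMatrix {n : ℕ} (w : Equiv.Perm (Fin n)) :
    ∃! L : Matrix (Equiv.Perm (Fin n)) (Equiv.Perm (Fin n)) (SeriesField n),
      IsMulMatrix w L := by
  choose L hL using fun v : Equiv.Perm (Fin n) =>
    exists_sub_sum_mem_fieldIdeal (polyToField n (schubert w) * gramSchmidtX v)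
  refine ⟨L, hL, fun L' hL' => ?_⟩
  ext v u
  have h := sub_mem (hL v) (hL' v)
  rw [sub_sub_sub_cancel_left, ← Finset.sum_sub_distrib] at h
  simp only [← sub_mul, ← C_sub] at h
  exact sub_eq_zero.mp (congrFun (eq_zero_of_sum_mem_fieldIdeal (fun u => L' v u - L v u) h) u)

theorem existsUnique_isDerivMatrix {n : ℕ} (w : Equiv.Perm (Fin n)) :
    ∃! M : Matrix (Equiv.Perm (Fin n)) (Equiv.Perm (Fin n)) (SeriesField n),
      IsDerivMatrix w M := by
  choose M hM using fun v : Equiv.Perm (Fin n) =>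
    exists_dtPoly_eq_sum w (gramSchmidtX_mem_span_codeMonomial v)
  refine ⟨M, hM, fun M' hM' => ?_⟩
  ext v u
  have h : ∑ u, C (M' v u - M v u) * gramSchmidtX u ∈ fieldIdeal n := by
    simp only [C_sub, sub_mul]
    rw [Finset.sum_sub_distrib, ← hM v, ← hM' v, sub_self]
    exact zero_mem _
  exact sub_eq_zero.mp (congrFun (eq_zero_of_sum_mem_fieldIdeal (fun u => M' v u - M v u) h) u)

theorem sum_C_mul_sum {n : ℕ} {A B : Matrix (Equiv.Perm (Fin n)) (Equiv.Perm (Fin n))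
    (SeriesField n)} (v : Equiv.Perm (Fin n)) :
    ∑ u, C (A v u) * ∑ s, C (B u s) * gramSchmidtX s = ∑ s, C ((A * B) v s) * gramSchmidtX s := by
  simp only [Matrix.mul_apply, map_sum, map_mul, Finset.sum_mul, Finset.mul_sum]
  rw [Finset.sum_comm]
  simp only [mul_assoc]

theorem lax_equation {n : ℕ} {u w : Equiv.Perm (Fin n)}
    {L M : Matrix (Equiv.Perm (Fin n)) (Equiv.Perm (Fin n)) (SeriesField n)}
    (hL : IsMulMatrix w L) (hM : IsDerivMatrix u M) : L.map (dt u) = M * L - L * M := by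
  ext v s
  -- The derivative of the defining congruence of L: S̃_w ∑ M X - ∑ (∂L) X - ∑ (LM) X lies in the
  -- ideal.
  have h1 := dtPoly_mem_fieldIdeal u (hL v)
  rw [dtPoly_sub, dtPoly_mul, dtPoly_polyToField, zero_mul, zero_add, dtPoly_sum, hM v] at h1
  simp only [dtPoly_mul, dtPoly_C] at h1
  have e1 : ∑ x, C (L v x) * dtPoly u (gramSchmidtX x) =
      ∑ s, C ((L * M) v s) * gramSchmidtX s := by
    rw [← sum_C_mul_sum]
    exact Finset.sum_congr rfl fun x _ => by rw [hM x]
  have e2 : polyToField n (schubert w) * ∑ x, C (M v x) * gramSchmidtX x =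
      ∑ x, C (M v x) * (polyToField n (schubert w) * gramSchmidtX x) := by
    rw [Finset.mul_sum]
    exact Finset.sum_congr rfl fun x _ => mul_left_comm _ _ _
  rw [Finset.sum_add_distrib, e1, e2] at h1
  -- The congruences for L, weighted by row v of M, turn S̃_w ∑ M X into ∑ (ML) X.
  have h2 : ∑ x, C (M v x) * (polyToField n (schubert w) * gramSchmidtX x -
      ∑ s, C (L x s) * gramSchmidtX s) ∈ fieldIdeal n :=
    Submodule.sum_mem _ fun x _ => Ideal.mul_mem_left _ _ (hL x)
  simp only [mul_sub] at h2
  rw [Finset.sum_sub_distrib, sum_C_mul_sum] at h2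
  have h3 := sub_mem h1 h2
  have h4 : ∑ s, C ((M * L - L * M) v s - L.map (dt u) v s) * gramSchmidtX s ∈ fieldIdeal n := by
    simp only [Matrix.sub_apply, Matrix.map_apply, C_sub, sub_mul, Finset.sum_sub_distrib]
    generalize ∑ x, C (M v x) * (polyToField n (schubert w) * gramSchmidtX x) = T at h3
    convert h3 using 1
    ring
  exact (sub_eq_zero.mp (congrFun (eq_zero_of_sum_mem_fieldIdeal _ h4) s)).symm

end FlagLax

end

open FlagLax

theorem lemmal2p10 (n : ℕ) :
    (∀ w : Equiv.Perm (Fin n), ∃! L : Matrix (Equiv.Perm (Fin n)) (Equiv.Perm (Fin n))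
      (SeriesField n), IsMulMatrix w L) ∧
    (∀ w : Equiv.Perm (Fin n), ∃! M : Matrix (Equiv.Perm (Fin n)) (Equiv.Perm (Fin n))
      (SeriesField n), IsDerivMatrix w M) ∧
    ∀ L M : Equiv.Perm (Fin n) → Matrix (Equiv.Perm (Fin n)) (Equiv.Perm (Fin n)) (SeriesField n),
      (∀ w, IsMulMatrix w (L w)) → (∀ w, IsDerivMatrix w (M w)) →
      ∀ u w, (L w).map (dt u) = M u * L w - L w * M u :=
  ⟨existsUnique_isMulMatrix, existsUnique_isDerivMatrix,
    fun _ _ hL hM u w => lax_equation (hL w) (hM u)⟩
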